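/- Let $P,N>0$ be real numbers. For an integer $L\ge 2$ and a finite set $\mathcal L\subset\mathbb R^n$ of $L$ points with centroid $\bar x=\frac1L\sum_{x\in\mathcal L}x$, put $\overline{\mathrm{rad}}^2(\mathcal L)=\frac1L\sum_{x\in\mathcal L}\|x-\bar x\|_2^2$. For a code $\mathcal C\subseteq\mathbb R^n$ let $\overline{\mathrm{rad}}^2_L(\mathcal C)$ be the infimum of $\overline{\mathrm{rad}}^2(\mathcal L)$ over all $L$-element subsets $\mathcal L$ of $\mathcal C$ ($+\infty$ if there are none), and let $R(\mathcal C)=\frac1n\ln|\mathcal C|$. The $(P,N,L-1)$-average-radius multiple packing density is $$\overline C_{L-1}(P,N)=\limsup_{n\to\infty}\ \sup\bigl\{R(\mathcal C):\ \mathcal C\subseteq\mathcal B^n(\sqrt{nP}),\ \overline{\mathrm{rad}}^2_L(\mathcal C)>nN\bigr\},$$ where $\mathcal B^n(r)$ is the closed Euclidean ball of radius $r$ around the origin. Theorem. For every integer $L\ge2$ with $\frac NP\le\frac{L-1}{L}$, $$\overline C_{L-1}(P,N)\ \ge\ \frac12\left[\ln\frac{(L-1)P}{LN}+\frac1{L-1}\ln\frac{P}{L(P-N)}\right],$$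 and the bound is already achieved by spherical codes: the same lower bound holds if in the definition of $\overline C_{L-1}(P,N)$ the supremum is restricted to codes $\mathcal C$ contained in the sphere of radius $\sqrt{nP}$ around the origin. Moreover, if $N<P$, the right-hand side tends to $\frac12\ln\frac PN$ as $L\to\infty$. -/

import Mathlib

noncomputable section

namespace AvgRadPacking

/-- The average squared radius of a finite list `s` of (distinct) points of `ℝⁿ`:
the average squared Euclidean distance of its points to their centroid. -/
def avgSqRadius {n : ℕ} (s : Finset (EuclideanSpace ℝ (Fin n))) : ℝ :=
  (1 / (s.card : ℝ)) * ∑ x ∈ s, ‖x - (1 / (s.card : ℝ)) • ∑ y ∈ s, y‖ ^ 2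

/-- The average squared radius of a code `C` with respect to lists of size `L`: the infimum of
the average squared radii of the `L`-element subsets of `C`. It is `⊤` if `C` has fewer than
`L` points; for finite codes with at least `L` points the infimum is a minimum. -/
def codeAvgSqRadius {n : ℕ} (L : ℕ) (C : Set (EuclideanSpace ℝ (Fin n))) : EReal :=
  ⨅ s ∈ {s : Finset (EuclideanSpace ℝ (Fin n)) | (s : Set (EuclideanSpace ℝ (Fin n))) ⊆ C ∧
    s.card = L}, (avgSqRadius s : EReal)

/-- The rate `(1 / n) ln |C|` of a code `C ⊆ ℝⁿ`, as an extended real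
(`⊥` for the empty code and `⊤` for infinite codes, when `n ≥ 1`). -/
def rate {n : ℕ} (C : Set (EuclideanSpace ℝ (Fin n))) : EReal :=
  ENNReal.log (C.encard : ENNReal) / (n : EReal)

/-- `C` is a `(P, N, L - 1)`-average-radius multiple packing (list-decodable code) in `ℝⁿ`. -/
def IsAvgRadPacking {n : ℕ} (P N : ℝ) (L : ℕ) (C : Set (EuclideanSpace ℝ (Fin n))) : Prop :=
  C ⊆ Metric.closedBall 0 √(n * P) ∧ ((n * N : ℝ) : EReal) < codeAvgSqRadius L C

/-- The `(P, N, L - 1)`-average-radius multiple packing density (list-decoding capacity). -/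
def capacity (P N : ℝ) (L : ℕ) : EReal :=
  Filter.limsup (fun n : ℕ =>
    ⨆ C ∈ {C : Set (EuclideanSpace ℝ (Fin n)) | IsAvgRadPacking P N L C}, rate C) Filter.atTop

/-- The same density with the packings restricted to spherical codes, that is, to subsets of
the sphere of radius `√(nP)` around the origin. -/
def sphericalCapacity (P N : ℝ) (L : ℕ) : EReal :=
  Filter.limsup (fun n : ℕ =>
    ⨆ C ∈ {C : Set (EuclideanSpace ℝ (Fin n)) | C ⊆ Metric.sphere 0 √(n * P) ∧
      IsAvgRadPacking P N L C}, rate C) Filter.atTop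

/-- The value `½ [ln ((L-1)P / (LN)) + (1/(L-1)) ln (P / (L(P-N)))]`. -/
def lowerBound (P N : ℝ) (L : ℕ) : ℝ :=
  1 / 2 * (Real.log (((L : ℝ) - 1) * P / (L * N)) +
    1 / ((L : ℝ) - 1) * Real.log (P / (L * (P - N))))

end AvgRadPacking

end

/-!
Sample `M` independent standard Gaussian vectors and project them to the sphere. For points on the
sphere of radius `√(nP)`, an `L`-list has average squared radius at most `nN` exactly when its
unit directions have a sum of squared norm at least `Lμ`, where `μ = L(P - N)/P`. The cheapest way
for Gaussian vectors of norm about `√n` to achieve this is to look like Gaussian vectors whose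
covariance is, in each coordinate, the `L × L` matrix with eigenvalue `μ` on the all-ones vector
and eigenvalue `κ = LN/((L - 1)P)` on its complement; this matrix has trace `L`, that is, the
norms keep their typical size. A Chernoff bound with the corresponding likelihood ratio as test
function gives probability at most `(μ κ ^ (L - 1)) ^ (n / 2)` up to subexponential factors.
Discarding one vector from every bad list, and all vectors of untypical norm, leaves a spherical
code of any rate below `-½ (ln κ + ln μ / (L - 1))`, which is the claimed bound.
-/

noncomputable section

namespace AvgRadPacking

open MeasureTheory ProbabilityTheory Module Filter Topology
open NormedSpace (normalize)
open scoped NNReal RealInnerProductSpace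

section ExponentialMoments

lemma measure_ge_le_exp_neg_mul_lintegral_exp {Ω : Type*} [MeasurableSpace Ω] {P : Measure Ω}
    {f : Ω → ℝ} (hf : AEMeasurable f P) (t : ℝ) :
    P {ω | t ≤ f ω} ≤
      ENNReal.ofReal (Real.exp (-t)) * ∫⁻ ω, ENNReal.ofReal (Real.exp (f ω)) ∂P := by
  have hset : {ω | t ≤ f ω} =
      {ω | ENNReal.ofReal (Real.exp t) ≤ ENNReal.ofReal (Real.exp (f ω))} := by
    ext ω
    simp only [Set.mem_ofPred_eq, ENNReal.ofReal_le_ofReal_iff (Real.exp_pos _).le,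
      Real.exp_le_exp]
  rw [hset, Real.exp_neg, ENNReal.ofReal_inv_of_pos (Real.exp_pos t), mul_comm, ← div_eq_mul_inv]
  exact meas_ge_le_lintegral_div (by fun_prop)
    (ENNReal.ofReal_pos.2 (Real.exp_pos t)).ne' ENNReal.ofReal_ne_top

lemma lintegral_pi_finset_prod {ι : Type*} [Fintype ι] {X : ι → Type*}
    [∀ i, MeasurableSpace (X i)] (ν : ∀ i, Measure (X i)) [∀ i, IsProbabilityMeasure (ν i)]
    (T : Finset ι) {h : ∀ i, X i → ENNReal} (hh : ∀ i, Measurable (h i)) :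
    ∫⁻ x, ∏ i ∈ T, h i (x i) ∂Measure.pi ν = ∏ i ∈ T, ∫⁻ y, h i y ∂ν i := by
  rw [lintegral_prod_eq_prod_lintegral_of_indepFun T (fun i (x : ∀ i, X i) => h i (x i))
    (iIndepFun_pi fun i => (hh i).aemeasurable) (fun i => (hh i).comp (measurable_pi_apply i))]
  exact Finset.prod_congr rfl fun i _ => (measurePreserving_eval ν i).lintegral_comp (hh i)

lemma lintegral_exp_quadratic_gaussianReal {κ : ℝ} (hκ : 0 < κ) (w : ℝ) :
    ∫⁻ y, ENNReal.ofReal (Real.exp (w * y + (1 - 1 / κ) / 2 * y ^ 2)) ∂gaussianReal 0 1 =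
      ENNReal.ofReal (√κ * Real.exp (κ / 2 * w ^ 2)) := by
  lift κ to ℝ≥0 using hκ.le
  -- Completing the square turns the integrand into a multiple of another Gaussian density.
  have hpdf (y : ℝ) : gaussianPDF 0 1 y *
      ENNReal.ofReal (Real.exp (w * y + (1 - 1 / (κ : ℝ)) / 2 * y ^ 2)) =
      ENNReal.ofReal (√κ * Real.exp (κ / 2 * w ^ 2)) * gaussianPDF (κ * w) κ y := by
    rw [gaussianPDF_def, gaussianPDF_def, ← ENNReal.ofReal_mul (gaussianPDFReal_nonneg _ _ _),
      ← ENNReal.ofReal_mul (by positivity), gaussianPDFReal_def, gaussianPDFReal_def]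
    congr 1
    calc _ = (√(2 * Real.pi))⁻¹ * Real.exp (-y ^ 2 / 2 + (w * y + (1 - 1 / κ) / 2 * y ^ 2)) := by
          rw [Real.exp_add (-y ^ 2 / 2), ← mul_assoc]
          simp
      _ = (√(2 * Real.pi))⁻¹ * Real.exp (κ / 2 * w ^ 2 + -(y - κ * w) ^ 2 / (2 * κ)) := by
          congr 2
          field_simp
          ring
      _ = _ := by
          rw [Real.exp_add, Real.sqrt_mul (by positivity) (κ : ℝ)]
          field_simp
  rw [gaussianReal_of_var_ne_zero 0 one_ne_zero,
    lintegral_withDensity_eq_lintegral_mul _ (by fun_prop) (by fun_prop)]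
  simp_rw [Pi.mul_apply, hpdf]
  rw [lintegral_const_mul _ (by fun_prop),
    lintegral_gaussianPDF_eq_one _ (by exact_mod_cast hκ.ne'), mul_one]

variable {E : Type*} [NormedAddCommGroup E] [InnerProductSpace ℝ E] [FiniteDimensional ℝ E]
  [MeasurableSpace E] [BorelSpace E]

lemma lintegral_exp_quadratic_stdGaussian {κ : ℝ} (hκ : 0 < κ) (w : E) :
    ∫⁻ y, ENNReal.ofReal (Real.exp (⟪w, y⟫ + (1 - 1 / κ) / 2 * ‖y‖ ^ 2)) ∂stdGaussian E =
      ENNReal.ofReal (√κ ^ finrank ℝ E * Real.exp (κ / 2 * ‖w‖ ^ 2)) := by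
  rw [stdGaussian, lintegral_map (by fun_prop) (by fun_prop)]
  set b := stdOrthonormalBasis ℝ E
  have hcoord (x : Fin (finrank ℝ E) → ℝ) :
      ENNReal.ofReal (Real.exp (⟪w, ∑ i, x i • b i⟫ + (1 - 1 / κ) / 2 * ‖∑ i, x i • b i‖ ^ 2)) =
      ∏ i, ENNReal.ofReal (Real.exp (⟪w, b i⟫ * x i + (1 - 1 / κ) / 2 * x i ^ 2)) := by
    have hnorm : ‖∑ i, x i • b i‖ ^ 2 = ∑ i, x i ^ 2 := by
      rw [← real_inner_self_eq_norm_sq, b.orthonormal.inner_sum]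
      simp [sq]
    rw [← ENNReal.ofReal_prod_of_nonneg fun _ _ => (Real.exp_pos _).le, ← Real.exp_sum, hnorm,
      inner_sum, Finset.sum_add_distrib, Finset.mul_sum]
    simp_rw [real_inner_smul_right, mul_comm (x _)]
  simp_rw [hcoord]
  rw [lintegral_pi_finset_prod (fun _ => gaussianReal 0 1) Finset.univ
    (h := fun i t => ENNReal.ofReal (Real.exp (⟪w, b i⟫ * t + (1 - 1 / κ) / 2 * t ^ 2)))
    fun i => by fun_prop]
  simp_rw [lintegral_exp_quadratic_gaussianReal hκ]
  rw [← ENNReal.ofReal_prod_of_nonneg fun _ _ => by positivity, Finset.prod_mul_distrib,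
    ← Real.exp_sum, ← Finset.mul_sum, ← b.sum_sq_inner_left w]
  simp

lemma lintegral_exp_norm_sq_stdGaussian {κ : ℝ} (hκ : 0 < κ) :
    ∫⁻ y, ENNReal.ofReal (Real.exp ((1 - 1 / κ) / 2 * ‖y‖ ^ 2)) ∂stdGaussian E =
      ENNReal.ofReal (√κ ^ finrank ℝ E) := by
  simpa using lintegral_exp_quadratic_stdGaussian hκ (0 : E)

end ExponentialMoments

section Shell

variable {E : Type*} [NormedAddCommGroup E] [InnerProductSpace ℝ E]

variable (E) in
/-- The typical set of the standard Gaussian measure on `E`: the vectors whose squared norm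
is between `1 - η` and `1 + η` times the dimension. -/
def shell (η : ℝ) : Set E :=
  {x | |‖x‖ ^ 2 - finrank ℝ E| ≤ η * finrank ℝ E}

lemma mem_shell {η : ℝ} {x : E} :
    x ∈ shell E η ↔ |‖x‖ ^ 2 - finrank ℝ E| ≤ η * finrank ℝ E :=
  Iff.rfl

lemma measurableSet_shell [MeasurableSpace E] [BorelSpace E] (η : ℝ) :
    MeasurableSet (shell E η) :=
  measurableSet_le (by fun_prop) (by fun_prop)

lemma ne_zero_of_mem_shell [Nontrivial E] [FiniteDimensional ℝ E] {η : ℝ} (hη : η < 1) {x : E}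
    (hx : x ∈ shell E η) : x ≠ 0 := by
  rintro rfl
  have hd : (0 : ℝ) < finrank ℝ E := by exact_mod_cast finrank_pos
  have hlow := (abs_le.1 (mem_shell.1 hx)).1
  rw [norm_zero] at hlow
  nlinarith

lemma norm_sqrt_smul_normalize_sub_le {η : ℝ} {x : E} (hη : 0 ≤ η) (hx : x ∈ shell E η) :
    ‖√(finrank ℝ E : ℝ) • normalize x - x‖ ≤ η * √(finrank ℝ E) := by
  set r := √(finrank ℝ E : ℝ)
  have hr : r ^ 2 = finrank ℝ E := Real.sq_sqrt (Nat.cast_nonneg _)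
  have hr0 : 0 ≤ r := Real.sqrt_nonneg _
  have hunit : ‖normalize x‖ ≤ 1 := by
    rcases eq_or_ne x 0 with rfl | h
    · simp
    · exact (NormedSpace.norm_normalize h).le
  have habs : |r - ‖x‖| ≤ η * r := by
    obtain ⟨hlow, hupp⟩ := abs_le.1 (mem_shell.1 hx)
    rw [← hr] at hlow hupp
    have hx0 := norm_nonneg x
    rw [abs_le]
    constructor <;> by_contra! h <;> nlinarith [mul_nonneg hη hr0]
  calc ‖r • normalize x - x‖ = |r - ‖x‖| * ‖normalize x‖ := by
        rw [← Real.norm_eq_abs, ← norm_smul, sub_smul, NormedSpace.norm_smul_normalize]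
    _ ≤ η * r * 1 := by gcongr
    _ = η * r := mul_one _

lemma le_norm_sum_of_mem_shell {ι : Type*} {η ρ : ℝ} (hη : 0 ≤ η) {T : Finset ι} {x : ι → E}
    (hx : ∀ i ∈ T, x i ∈ shell E η) (hρ : ρ ≤ ‖∑ i ∈ T, normalize (x i)‖ ^ 2) :
    √(finrank ℝ E) * (√ρ - T.card * η) ≤ ‖∑ i ∈ T, x i‖ := by
  set r := √(finrank ℝ E : ℝ)
  have hdist : ‖r • ∑ i ∈ T, normalize (x i) - ∑ i ∈ T, x i‖ ≤ T.card * (η * r) := by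
    rw [Finset.smul_sum, ← Finset.sum_sub_distrib, ← nsmul_eq_mul, ← Finset.sum_const]
    exact norm_sum_le_of_le T fun i hi => norm_sqrt_smul_normalize_sub_le hη (hx i hi)
  have htri := norm_sub_norm_le (r • ∑ i ∈ T, normalize (x i)) (∑ i ∈ T, x i)
  rw [norm_smul, Real.norm_of_nonneg (Real.sqrt_nonneg _)] at htri
  have hsqrt : r * √ρ ≤ r * ‖∑ i ∈ T, normalize (x i)‖ := by
    gcongr
    exact Real.sqrt_le_iff.2 ⟨norm_nonneg _, hρ⟩
  linarith

variable [FiniteDimensional ℝ E] [MeasurableSpace E] [BorelSpace E]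

/-- This is an upper tail bound for `1 < s` and a lower tail bound for `s < 1`. -/
lemma stdGaussian_norm_sq_tail_le {s : ℝ} (hs : 0 < s) :
    stdGaussian E {x | 0 ≤ (s - 1) * (‖x‖ ^ 2 - s * finrank ℝ E)} ≤
      ENNReal.ofReal (√(s * Real.exp (1 - s)) ^ finrank ℝ E) := by
  have hset : {x : E | 0 ≤ (s - 1) * (‖x‖ ^ 2 - s * finrank ℝ E)} =
      {x | (s - 1) / 2 * finrank ℝ E ≤ (1 - 1 / s) / 2 * ‖x‖ ^ 2} := by
    ext x
    have hgap : (1 - 1 / s) / 2 * ‖x‖ ^ 2 - (s - 1) / 2 * finrank ℝ E =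
        (s - 1) * (‖x‖ ^ 2 - s * finrank ℝ E) / (2 * s) := by
      field_simp
    rw [Set.mem_ofPred_eq, Set.mem_ofPred_eq, ← sub_nonneg (b := _ * (finrank ℝ E : ℝ)), hgap,
      le_div_iff₀ (by positivity), zero_mul]
  rw [hset]
  refine (measure_ge_le_exp_neg_mul_lintegral_exp (by fun_prop) _).trans_eq ?_
  rw [lintegral_exp_norm_sq_stdGaussian hs, ← ENNReal.ofReal_mul (Real.exp_pos _).le,
    Real.sqrt_mul hs.le, ← Real.exp_half, mul_pow, ← Real.exp_nat_mul, mul_comm]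
  ring_nf

lemma tendsto_stdGaussian_norm_sq_tail {s : ℝ} (hs : 0 < s) (hs1 : s ≠ 1) :
    Tendsto (fun n : ℕ => stdGaussian (EuclideanSpace ℝ (Fin n))
      {x | 0 ≤ (s - 1) * (‖x‖ ^ 2 - s * n)}) atTop (𝓝 0) := by
  have hbase : √(s * Real.exp (1 - s)) < 1 := by
    have hexp := Real.add_one_lt_exp (sub_ne_zero.2 hs1)
    rw [Real.sqrt_lt' one_pos, ← neg_sub s 1, Real.exp_neg, ← div_eq_mul_inv, one_pow,
      div_lt_one (Real.exp_pos _)]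
    linarith
  have hpow := ENNReal.tendsto_ofReal
    (tendsto_pow_atTop_nhds_zero_of_lt_one (Real.sqrt_nonneg _) hbase)
  rw [ENNReal.ofReal_zero] at hpow
  refine tendsto_of_tendsto_of_tendsto_of_le_of_le tendsto_const_nhds hpow (fun _ => zero_le)
    fun n => ?_
  simpa using stdGaussian_norm_sq_tail_le (E := EuclideanSpace ℝ (Fin n)) hs

lemma tendsto_stdGaussian_compl_shell {η : ℝ} (hη : 0 < η) (hη1 : η < 1) :
    Tendsto (fun n : ℕ => (stdGaussian (EuclideanSpace ℝ (Fin n))).real (shell _ η)ᶜ)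
      atTop (𝓝 0) := by
  have htails := (tendsto_stdGaussian_norm_sq_tail (s := 1 - η) (by linarith) (by linarith)).add
    (tendsto_stdGaussian_norm_sq_tail (s := 1 + η) (by linarith) (by linarith))
  rw [add_zero] at htails
  refine (ENNReal.tendsto_toReal ENNReal.zero_ne_top).comp
    (tendsto_of_tendsto_of_tendsto_of_le_of_le tendsto_const_nhds htails (fun _ => zero_le)
      fun n => (measure_mono fun x hx => ?_).trans (measure_union_le _ _))
  simp only [shell, Set.mem_compl_iff, Set.mem_ofPred_eq, not_le, finrank_euclideanSpace_fin,
    lt_abs] at hx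
  simp only [Set.mem_union, Set.mem_ofPred_eq]
  rcases hx with hx | hx
  · right; nlinarith
  · left; nlinarith

end Shell

section Tilt

variable {E : Type*} [NormedAddCommGroup E] [InnerProductSpace ℝ E] {ι : Type*}

/-- The log-likelihood ratio, up to its normalizing constant, between two laws of a family
`(x i)_{i ∈ T}` in `E`: the Gaussian law under which, in each coordinate, the covariance matrix
has eigenvalue `μ` on the all-ones vector and eigenvalue `κ` on its orthogonal complement, and the
law of independent standard Gaussian vectors. -/
def tiltExponent (κ μ : ℝ) (T : Finset ι) (x : ι → E) : ℝ :=
  (1 - 1 / κ) / 2 * ∑ i ∈ T, ‖x i‖ ^ 2 + (1 / κ - 1 / μ) / (2 * T.card) * ‖∑ i ∈ T, x i‖ ^ 2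

lemma le_tiltExponent_of_mem_shell {κ μ η ρ : ℝ} (hκ : 0 < κ) (hκ1 : κ ≤ 1) (hκμ : κ ≤ μ)
    (hη : 0 ≤ η) {T : Finset ι} {x : ι → E} (hx : ∀ i ∈ T, x i ∈ shell E η)
    (hηρ : T.card * η ≤ √ρ) (hρ : ρ ≤ ‖∑ i ∈ T, normalize (x i)‖ ^ 2) :
    finrank ℝ E * ((1 - 1 / κ) / 2 * (T.card * (1 + η)) +
      (1 / κ - 1 / μ) / (2 * T.card) * (√ρ - T.card * η) ^ 2) ≤ tiltExponent κ μ T x := by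
  set d := (finrank ℝ E : ℝ)
  have hnorms : ∑ i ∈ T, ‖x i‖ ^ 2 ≤ T.card * (d * (1 + η)) := by
    rw [← nsmul_eq_mul]
    refine Finset.sum_le_card_nsmul _ _ _ fun i hi => ?_
    linarith [(abs_le.1 (mem_shell.1 (hx i hi))).2]
  have hsum : d * (√ρ - T.card * η) ^ 2 ≤ ‖∑ i ∈ T, x i‖ ^ 2 := by
    have h := pow_le_pow_left₀ (mul_nonneg (Real.sqrt_nonneg _) (sub_nonneg.2 hηρ))
      (le_norm_sum_of_mem_shell hη hx hρ) 2
    rwa [mul_pow, Real.sq_sqrt (Nat.cast_nonneg _)] at h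
  have ha : (1 - 1 / κ) / 2 ≤ 0 := by
    linarith [(one_le_div hκ).2 hκ1]
  have hc : 0 ≤ (1 / κ - 1 / μ) / (2 * T.card) :=
    div_nonneg (sub_nonneg.2 (one_div_le_one_div_of_le hκ hκμ)) (by positivity)
  rw [tiltExponent]
  linarith [mul_le_mul_of_nonpos_left hnorms ha, mul_le_mul_of_nonneg_left hsum hc]

/-- The trace condition `hsum` makes the exponent vanish at `η = 0`. -/
lemma eventually_neg_le_tilt_bound {L κ μ ε : ℝ} (hL : 0 < L) (hκ : κ ≠ 0) (hμ : 0 < μ)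
    (hsum : μ + (L - 1) * κ = L) (hε : 0 < ε) :
    ∀ᶠ η in 𝓝 (0 : ℝ), L * η ≤ √(L * μ) ∧
      -ε ≤ (1 - 1 / κ) / 2 * (L * (1 + η)) +
        (1 / κ - 1 / μ) / (2 * L) * (√(L * μ) - L * η) ^ 2 := by
  have hsqrt : L * 0 < √(L * μ) := by rw [mul_zero]; positivity
  have hzero : (1 - 1 / κ) / 2 * (L * (1 + 0)) +
      (1 / κ - 1 / μ) / (2 * L) * (√(L * μ) - L * 0) ^ 2 = 0 := by
    rw [mul_zero, sub_zero, Real.sq_sqrt (by positivity)]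
    field_simp
    linear_combination hsum
  have hcont₁ : Continuous fun η : ℝ => L * η := by fun_prop
  have hcont₂ : Continuous fun η : ℝ => (1 - 1 / κ) / 2 * (L * (1 + η)) +
      (1 / κ - 1 / μ) / (2 * L) * (√(L * μ) - L * η) ^ 2 := by fun_prop
  filter_upwards [(hcont₁.tendsto 0).eventually_le_const hsqrt,
    (hcont₂.tendsto 0).eventually_const_le (u := -ε) (by rw [hzero]; linarith)] with η h₁ h₂
  exact ⟨h₁, h₂⟩

variable [FiniteDimensional ℝ E] [MeasurableSpace E] [BorelSpace E]

/-- The families whose members indexed by `T` have typical norms while the directions of these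
members are aligned, in the sense that their sum has squared norm at least `ρ`. -/
def alignedFamilies (η ρ : ℝ) (T : Finset ι) : Set (ι → E) :=
  {x | (∀ i ∈ T, x i ∈ shell E η) ∧ ρ ≤ ‖∑ i ∈ T, normalize (x i)‖ ^ 2}

lemma measurableSet_alignedFamilies (η ρ : ℝ) (T : Finset ι) :
    MeasurableSet (alignedFamilies (E := E) η ρ T) := by
  have hshell : MeasurableSet {x : ι → E | ∀ i ∈ T, x i ∈ shell E η} := by
    simp_rw [Set.ofPred_forall]
    exact T.measurableSet_biInter fun i _ => measurable_pi_apply i (measurableSet_shell η)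
  have hdir : Measurable fun x : ι → E => ‖∑ i ∈ T, normalize (x i)‖ ^ 2 := by
    unfold NormedSpace.normalize
    fun_prop
  exact hshell.inter (measurableSet_le measurable_const hdir)

/-- Linearization of the square `‖∑ i ∈ T, x i‖ ^ 2` by an auxiliary Gaussian vector `z`, which
decouples the vectors `x i`. -/
lemma exp_tiltExponent_eq_lintegral {κ μ : ℝ} (hκ : 0 < κ) (hκμ : κ ≤ μ) (T : Finset ι)
    (x : ι → E) :
    ENNReal.ofReal (Real.exp (tiltExponent κ μ T x)) =
      ∫⁻ z, ∏ i ∈ T, ENNReal.ofReal (Real.exp (⟪√((1 / κ - 1 / μ) / T.card) • z, x i⟫ +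
        (1 - 1 / κ) / 2 * ‖x i‖ ^ 2)) ∂stdGaussian E := by
  set c := (1 / κ - 1 / μ) / T.card with hc
  have hc0 : 0 ≤ c :=
    div_nonneg (sub_nonneg.2 (one_div_le_one_div_of_le hκ hκμ)) (Nat.cast_nonneg _)
  set a := (1 - 1 / κ) / 2 * ∑ i ∈ T, ‖x i‖ ^ 2 with ha
  have htilt : tiltExponent κ μ T x = a + 1 / 2 * ‖√c • ∑ i ∈ T, x i‖ ^ 2 := by
    rw [tiltExponent, norm_smul, mul_pow, Real.norm_of_nonneg (Real.sqrt_nonneg c),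
      Real.sq_sqrt hc0, hc, ha]
    ring
  have hgauss := lintegral_exp_quadratic_stdGaussian one_pos (√c • ∑ i ∈ T, x i)
  simp only [div_one, sub_self, zero_div, zero_mul, add_zero, Real.sqrt_one, one_pow,
    one_mul] at hgauss
  rw [htilt, Real.exp_add, ENNReal.ofReal_mul (Real.exp_pos _).le, ← hgauss,
    ← lintegral_const_mul _ (by fun_prop)]
  refine lintegral_congr fun z => ?_
  rw [← ENNReal.ofReal_mul (Real.exp_pos _).le, ← Real.exp_add,
    ← ENNReal.ofReal_prod_of_nonneg fun _ _ => (Real.exp_pos _).le, ← Real.exp_sum,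
    Finset.sum_add_distrib, ← Finset.mul_sum, ← inner_sum, real_inner_smul_left,
    real_inner_smul_left, real_inner_comm, add_comm]

variable [Fintype ι]

lemma lintegral_exp_tiltExponent {κ μ : ℝ} (hκ : 0 < κ) (hκμ : κ ≤ μ) {T : Finset ι}
    (hT : T.Nonempty) :
    ∫⁻ x, ENNReal.ofReal (Real.exp (tiltExponent κ μ T x))
      ∂Measure.pi (fun _ : ι => stdGaussian E) =
      ENNReal.ofReal (√(μ * κ ^ (T.card - 1)) ^ finrank ℝ E) := by
  have hμ : 0 < μ := hκ.trans_le hκμ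
  set d := finrank ℝ E
  set L := T.card with hL
  have hL0 : (L : ℝ) ≠ 0 := by exact_mod_cast hT.card_ne_zero
  set c := (1 / κ - 1 / μ) / L with hc
  have hc0 : 0 ≤ c :=
    div_nonneg (sub_nonneg.2 (one_div_le_one_div_of_le hκ hκμ)) (Nat.cast_nonneg _)
  have hsqrt : √κ ^ L * √(μ / κ) = √(μ * κ ^ (L - 1)) := by
    rw [eq_comm, Real.sqrt_eq_iff_mul_self_eq (by positivity) (by positivity),
      mul_mul_mul_comm, Real.mul_self_sqrt (by positivity), ← mul_pow, Real.mul_self_sqrt hκ.le,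
      hL, ← pow_sub_one_mul hT.card_ne_zero κ]
    field_simp
  simp_rw [exp_tiltExponent_eq_lintegral hκ hκμ]
  rw [lintegral_lintegral_swap (by fun_prop)]
  calc _ = ∫⁻ z, ∏ _i ∈ T, ENNReal.ofReal (√κ ^ d * Real.exp (κ / 2 * ‖√c • z‖ ^ 2))
        ∂stdGaussian E := by
        refine lintegral_congr fun z => ?_
        rw [lintegral_pi_finset_prod (fun _ => stdGaussian E) T
          (h := fun _ y => ENNReal.ofReal (Real.exp (⟪√c • z, y⟫ + (1 - 1 / κ) / 2 * ‖y‖ ^ 2)))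
          fun _ => by fun_prop]
        simp_rw [lintegral_exp_quadratic_stdGaussian hκ]
        rfl
    _ = ∫⁻ z, ENNReal.ofReal ((√κ ^ d) ^ L) *
        ENNReal.ofReal (Real.exp ((1 - 1 / (μ / κ)) / 2 * ‖z‖ ^ 2)) ∂stdGaussian E := by
        refine lintegral_congr fun z => ?_
        rw [Finset.prod_const, ← hL, ← ENNReal.ofReal_pow (by positivity), mul_pow,
          ENNReal.ofReal_mul (by positivity), ← Real.exp_nat_mul, norm_smul, mul_pow,
          Real.norm_of_nonneg (Real.sqrt_nonneg c), Real.sq_sqrt hc0]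
        congr 3
        rw [hc]
        field_simp
    _ = ENNReal.ofReal (√(μ * κ ^ (L - 1)) ^ d) := by
        rw [lintegral_const_mul _ (by fun_prop), lintegral_exp_norm_sq_stdGaussian (by positivity),
          ← ENNReal.ofReal_mul (by positivity), ← hsqrt, mul_pow, pow_right_comm]

lemma measure_alignedFamilies_le {κ μ η ρ ε : ℝ} (hκ : 0 < κ) (hκ1 : κ ≤ 1) (hκμ : κ ≤ μ)
    (hη : 0 ≤ η) {T : Finset ι} (hT : T.Nonempty) (hηρ : T.card * η ≤ √ρ)
    (hε : -ε ≤ (1 - 1 / κ) / 2 * (T.card * (1 + η)) +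
      (1 / κ - 1 / μ) / (2 * T.card) * (√ρ - T.card * η) ^ 2) :
    (Measure.pi fun _ : ι => stdGaussian E).real (alignedFamilies η ρ T) ≤
      (Real.exp ε * √(μ * κ ^ (T.card - 1))) ^ finrank ℝ E := by
  refine ENNReal.toReal_le_of_le_ofReal (by positivity) ?_
  calc _ ≤ Measure.pi (fun _ : ι => stdGaussian E)
        {x | -(finrank ℝ E * ε) ≤ tiltExponent κ μ T x} := by
        refine measure_mono fun x ⟨hx, hρ⟩ => ?_
        refine le_trans ?_ (le_tiltExponent_of_mem_shell hκ hκ1 hκμ hη hx hηρ hρ)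
        rw [← mul_neg]
        gcongr
    _ ≤ ENNReal.ofReal (Real.exp (-(-(finrank ℝ E * ε)))) *
        ∫⁻ x, ENNReal.ofReal (Real.exp (tiltExponent κ μ T x))
          ∂Measure.pi (fun _ : ι => stdGaussian E) :=
        measure_ge_le_exp_neg_mul_lintegral_exp (by unfold tiltExponent; fun_prop) _
    _ = _ := by
        rw [lintegral_exp_tiltExponent hκ hκμ hT, ← ENNReal.ofReal_mul (Real.exp_pos _).le,
          neg_neg, mul_pow, Real.exp_nat_mul]

end Tilt

section RandomCoding

open scoped Classical in
lemma exists_card_filter_le_sum_measureReal {Ω κ : Type*} [MeasurableSpace Ω] (P : Measure Ω)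
    [IsProbabilityMeasure P] (F : Finset κ) {A : κ → Set Ω}
    (hA : ∀ k ∈ F, MeasurableSet (A k)) :
    ∃ ω, ({k ∈ F | ω ∈ A k}.card : ℝ) ≤ ∑ k ∈ F, P.real (A k) := by
  have hint : ∀ k ∈ F, Integrable ((A k).indicator (1 : Ω → ℝ)) P := fun k hk =>
    (integrable_const 1).indicator (hA k hk)
  obtain ⟨ω, hω⟩ := exists_le_integral (integrable_finsetSum F hint)
  refine ⟨ω, ?_⟩
  rw [integral_finsetSum F hint,
    Finset.sum_congr rfl fun k hk => integral_indicator_one (hA k hk)] at hω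
  simpa only [Finset.card_filter, Nat.cast_sum, Set.indicator_apply, Pi.one_apply, Nat.cast_ite,
    Nat.cast_one, Nat.cast_zero] using hω

lemma exists_card_le_forall_not_subset {ι κ : Type*} [Fintype ι] (F : Finset κ)
    {e : κ → Finset ι} (he : ∀ k ∈ F, (e k).Nonempty) :
    ∃ I : Finset ι, Fintype.card ι ≤ I.card + F.card ∧ ∀ k ∈ F, ¬e k ⊆ I := by
  classical
  choose f hf using he
  refine ⟨(F.attach.image fun k => f k.1 k.2)ᶜ, ?_, fun k hk hsub => ?_⟩
  · have himage := Finset.card_image_le (s := F.attach) (f := fun k => f k.1 k.2)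
    rw [Finset.card_attach] at himage
    rw [Finset.card_compl]
    omega
  · exact Finset.mem_compl.1 (hsub (hf k hk))
      (Finset.mem_image_of_mem (fun k => f k.1 k.2) (Finset.mem_attach F ⟨k, hk⟩))

lemma exists_sample_avoiding {X ι : Type*} [MeasurableSpace X] [Fintype ι] {ν : Measure X}
    [IsProbabilityMeasure ν] {G : Set X} (hG : MeasurableSet G) {B : Finset ι → Set (ι → X)}
    (hB : ∀ T, MeasurableSet (B T)) {L K : ℕ} (hL : L ≠ 0) {p : ℝ}
    (hp : ∀ T : Finset ι, T.card = L → (Measure.pi fun _ => ν).real (B T) ≤ p)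
    (hK : Fintype.card ι * ν.real Gᶜ + (Fintype.card ι).choose L * p ≤ K) :
    ∃ (x : ι → X) (I : Finset ι), Fintype.card ι ≤ I.card + K ∧ (∀ i ∈ I, x i ∈ G) ∧
      ∀ T ⊆ I, T.card = L → x ∉ B T := by
  classical
  -- A defect is either a single index outside `G` or a bad `L`-set of indices.
  let defects : Finset (ι ⊕ Finset ι) := Finset.univ.disjSum (Finset.univ.powersetCard L)
  let A : ι ⊕ Finset ι → Set (ι → X) := Sum.elim (fun i => Function.eval i ⁻¹' Gᶜ) B
  let supp : ι ⊕ Finset ι → Finset ι := Sum.elim singleton id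
  have hA : ∀ k ∈ defects, MeasurableSet (A k) := by
    rintro (i | T) -
    exacts [measurable_pi_apply i hG.compl, hB T]
  have hsupp : ∀ k ∈ defects, (supp k).Nonempty := by
    rintro (i | T) hk
    · exact Finset.singleton_nonempty i
    · rw [Finset.inr_mem_disjSum, Finset.mem_powersetCard_univ] at hk
      exact Finset.card_pos.1 (by dsimp only [supp, Sum.elim_inr, id]; omega)
  obtain ⟨x, hx⟩ := exists_card_filter_le_sum_measureReal (Measure.pi fun _ : ι => ν) defects hA
  obtain ⟨I, hI, hnot⟩ := exists_card_le_forall_not_subset {k ∈ defects | x ∈ A k}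
    fun k hk => hsupp k (Finset.mem_filter.1 hk).1
  have hfew : ({k ∈ defects | x ∈ A k}.card : ℝ) ≤ K := by
    refine hx.trans (le_trans ?_ hK)
    rw [Finset.sum_disjSum]
    refine add_le_add (le_of_eq ?_) ?_
    · rw [← Finset.card_univ, ← nsmul_eq_mul]
      exact Finset.sum_eq_card_nsmul fun i _ => (measurePreserving_eval (fun _ : ι => ν)
        i).measureReal_preimage hG.compl.nullMeasurableSet
    · rw [← Finset.card_univ, ← Finset.card_powersetCard, ← nsmul_eq_mul]
      exact Finset.sum_le_card_nsmul _ _ _ fun T hT => hp T (Finset.mem_powersetCard_univ.1 hT)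
  refine ⟨x, I, hI.trans (by gcongr; exact_mod_cast hfew), fun i hi => ?_, fun T hT hTL hxT => ?_⟩
  · by_contra hxi
    exact hnot (.inl i) (Finset.mem_filter.2 ⟨by simp [defects], hxi⟩)
      (Finset.singleton_subset_iff.2 hi)
  · exact hnot (.inr T) (Finset.mem_filter.2 ⟨by simp [defects, hTL], hxT⟩) hT

lemma exists_unit_code_of_family {E ι : Type*} [NormedAddCommGroup E] [NormedSpace ℝ E]
    {I : Finset ι} {u : ι → E} (hu : ∀ i ∈ I, ‖u i‖ = 1) {L : ℕ} {ρ : ℝ} (hρ : ρ ≤ L ^ 2)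
    (hsum : ∀ T ⊆ I, T.card = L → ‖∑ i ∈ T, u i‖ ^ 2 < ρ) :
    ∃ C : Finset E, (∀ x ∈ C, ‖x‖ = 1) ∧
      (∀ s ⊆ C, s.card = L → ‖∑ x ∈ s, x‖ ^ 2 < ρ) ∧ I.card ≤ L * C.card := by
  classical
  refine ⟨I.image u, by simpa using hu, fun s hs hsL => ?_,
    Finset.card_le_mul_card_image I L fun y hy => ?_⟩
  · obtain ⟨T, hTI, hinj, rfl⟩ := Finset.exists_subset_injOn_image_eq_of_surjOn (f := u) (I : Set _)
      s fun y hy => by simpa using hs (Finset.mem_coe.1 hy)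
    rw [Finset.sum_image hinj]
    exact hsum T (by exact_mod_cast hTI) (by rw [← hsL, Finset.card_image_of_injOn hinj])
  · -- `L` indices with the same unit vector would have a sum of squared norm `L ^ 2`.
    by_contra! hlt
    obtain ⟨T, hT, hTL⟩ := Finset.exists_subset_card_eq hlt.le
    have hsmul : ∑ i ∈ T, u i = (L : ℝ) • y := by
      rw [Finset.sum_congr rfl fun i hi => (Finset.mem_filter.1 (hT hi)).2, Finset.sum_const,
        hTL, Nat.cast_smul_eq_nsmul]
    obtain ⟨i, hi, rfl⟩ := Finset.mem_image.1 hy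
    have hlarge := hsum T (hT.trans (Finset.filter_subset _ _)) hTL
    rw [hsmul, norm_smul, hu i hi, mul_one, Real.norm_natCast] at hlarge
    exact absurd hlarge hρ.not_gt

lemma exists_unit_code {E : Type*} [NormedAddCommGroup E] [InnerProductSpace ℝ E]
    [FiniteDimensional ℝ E] [MeasurableSpace E] [BorelSpace E] [Nontrivial E]
    {κ μ η ε : ℝ} {L K : ℕ} (hL : L ≠ 0) (hκ : 0 < κ) (hκ1 : κ ≤ 1) (hκμ : κ ≤ μ) (hμL : μ ≤ L)
    (hη : 0 ≤ η) (hη1 : η < 1) (hηρ : L * η ≤ √(L * μ))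
    (hε : -ε ≤ (1 - 1 / κ) / 2 * (L * (1 + η)) +
      (1 / κ - 1 / μ) / (2 * L) * (√(L * μ) - L * η) ^ 2)
    (hshell : (stdGaussian E).real (shell E η)ᶜ ≤ 1 / 4)
    (hK : (2 * K : ℝ) ^ (L - 1) * (Real.exp ε * √(μ * κ ^ (L - 1))) ^ finrank ℝ E ≤ 1 / 4) :
    ∃ C : Finset E, (∀ x ∈ C, ‖x‖ = 1) ∧
      (∀ s ⊆ C, s.card = L → ‖∑ x ∈ s, x‖ ^ 2 < L * μ) ∧ K ≤ L * C.card := by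
  have hexpected : ((2 * K : ℕ) : ℝ) * (stdGaussian E).real (shell E η)ᶜ +
      (2 * K).choose L * (Real.exp ε * √(μ * κ ^ (L - 1))) ^ finrank ℝ E ≤ K := by
    set p := (Real.exp ε * √(μ * κ ^ (L - 1))) ^ finrank ℝ E
    have hchoose : ((2 * K).choose L : ℝ) * p ≤ 2 * K * (1 / 4) :=
      calc _ ≤ ((2 * K : ℕ) : ℝ) ^ L * p := by
            gcongr
            exact_mod_cast Nat.choose_le_pow _ _
        _ = 2 * K * ((2 * K : ℝ) ^ (L - 1) * p) := by
            push_cast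
            rw [← mul_pow_sub_one hL, mul_assoc]
        _ ≤ 2 * K * (1 / 4) := by gcongr
    have houtliers := mul_le_mul_of_nonneg_left hshell (Nat.cast_nonneg (α := ℝ) (2 * K))
    push_cast at houtliers ⊢
    linarith
  have haligned (T : Finset (Fin (2 * K))) (hT : T.card = L) :
      (Measure.pi fun _ => stdGaussian E).real (alignedFamilies η (L * μ) T) ≤
        (Real.exp ε * √(μ * κ ^ (L - 1))) ^ finrank ℝ E := by
    subst hT
    exact measure_alignedFamilies_le hκ hκ1 hκμ hη (Finset.card_ne_zero.1 hL) hηρ hε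
  obtain ⟨x, I, hI, hxI, havoid⟩ := exists_sample_avoiding (measurableSet_shell η)
    (measurableSet_alignedFamilies η (L * μ)) hL haligned (by rwa [Fintype.card_fin])
  obtain ⟨C, hC, hCsum, hcard⟩ := exists_unit_code_of_family (u := fun i => normalize (x i))
    (fun i hi => NormedSpace.norm_normalize (ne_zero_of_mem_shell hη1 (hxI i hi)))
    (show L * μ ≤ (L : ℝ) ^ 2 by rw [sq]; gcongr)
    fun T hT hTL => not_le.1 fun h => havoid T hT hTL ⟨fun i hi => hxI i (hT hi), h⟩
  rw [Fintype.card_fin] at hI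
  exact ⟨C, hC, hCsum, by omega⟩

lemma eventually_ceil_pow_mul_pow_le {R A b δ : ℝ} {k : ℕ} (hR : 0 ≤ R) (hA : 1 ≤ A) (hb : 0 ≤ b)
    (hRb : Real.exp R ^ k * b < 1) (hδ : 0 < δ) :
    ∀ᶠ n : ℕ in atTop, (2 * ⌈A * Real.exp (n * R)⌉₊ : ℝ) ^ k * b ^ n ≤ δ := by
  have hlim : Tendsto (fun n : ℕ => (4 * A) ^ k * (Real.exp R ^ k * b) ^ n) atTop (𝓝 0) := by
    simpa using (tendsto_pow_atTop_nhds_zero_of_lt_one (by positivity) hRb).const_mul ((4 * A) ^ k)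
  filter_upwards [hlim.eventually_le_const hδ] with n hn
  have hceil : (⌈A * Real.exp (n * R)⌉₊ : ℝ) ≤ 2 * (A * Real.exp R ^ n) := by
    rw [← Real.exp_nat_mul]
    exact Nat.ceil_le_two_mul ((by norm_num : (2 : ℝ)⁻¹ ≤ 1).trans
      (one_le_mul_of_one_le_of_one_le hA (Real.one_le_exp (by positivity))))
  calc _ ≤ (2 * (2 * (A * Real.exp R ^ n))) ^ k * b ^ n := by gcongr
    _ = (4 * A) ^ k * (Real.exp R ^ k * b) ^ n := by ring
    _ ≤ δ := hn

lemma eventually_exists_unit_code {κ μ R : ℝ} {L : ℕ} (hL : 2 ≤ L) (hκ : 0 < κ) (hκ1 : κ ≤ 1)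
    (hsum : μ + (L - 1) * κ = L) (hR : 0 ≤ R)
    (hRκμ : Real.exp R ^ (L - 1) * √(μ * κ ^ (L - 1)) < 1) :
    ∀ᶠ n : ℕ in atTop, ∃ C : Finset (EuclideanSpace ℝ (Fin n)), (∀ x ∈ C, ‖x‖ = 1) ∧
      (∀ s ⊆ C, s.card = L → ‖∑ x ∈ s, x‖ ^ 2 < L * μ) ∧ Real.exp (n * R) ≤ C.card := by
  have hL2 : (2 : ℝ) ≤ L := by exact_mod_cast hL
  have hμ1 : 1 ≤ μ := by nlinarith
  have hμL : μ ≤ L := by nlinarith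
  obtain ⟨ε, hε, hεlt⟩ : ∃ ε > 0,
      Real.exp R ^ (L - 1) * (Real.exp ε * √(μ * κ ^ (L - 1))) < 1 := by
    have hcont : Continuous fun ε : ℝ =>
        Real.exp R ^ (L - 1) * (Real.exp ε * √(μ * κ ^ (L - 1))) := by fun_prop
    have hev := (hcont.tendsto 0).mono_left (nhdsWithin_le_nhds (s := Set.Ioi 0))
      |>.eventually_lt_const (by simpa using hRκμ)
    obtain ⟨ε, hε, hpos⟩ := (hev.and self_mem_nhdsWithin).exists
    exact ⟨ε, hpos, hε⟩
  obtain ⟨η, ⟨hηρ, hηε⟩, hη, hη1⟩ := (((eventually_neg_le_tilt_bound (L := L) (by linarith) hκ.ne'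
    (by linarith) hsum hε).filter_mono (nhdsWithin_le_nhds (s := Set.Ioi 0))).and
      (Ioo_mem_nhdsGT one_pos)).exists
  filter_upwards [
    (tendsto_stdGaussian_compl_shell hη hη1).eventually_le_const (show (0 : ℝ) < 1 / 4 by norm_num),
    eventually_ceil_pow_mul_pow_le (A := L) (δ := 1 / 4) hR (by linarith) (by positivity) hεlt
      (by norm_num),
    eventually_gt_atTop 0] with n hshell hK hn
  have : Nonempty (Fin n) := ⟨⟨0, hn⟩⟩
  obtain ⟨C, hC, hCsum, hcard⟩ := exists_unit_code (by omega) hκ hκ1 (hκ1.trans hμ1) hμL hη.le hη1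
    hηρ hηε hshell (by rwa [finrank_euclideanSpace_fin])
  refine ⟨C, hC, hCsum, le_of_mul_le_mul_left ?_ (by linarith : (0 : ℝ) < L)⟩
  exact (Nat.le_ceil _).trans (by exact_mod_cast hcard)

end RandomCoding

section Packing

variable {n L : ℕ} {P N : ℝ}

lemma avgSqRadius_eq (s : Finset (EuclideanSpace ℝ (Fin n))) :
    avgSqRadius s = (∑ x ∈ s, ‖x‖ ^ 2) / s.card - ‖∑ x ∈ s, x‖ ^ 2 / s.card ^ 2 := by
  rcases s.eq_empty_or_nonempty with rfl | hs
  · simp [avgSqRadius]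
  have hcard : (s.card : ℝ) ≠ 0 := by exact_mod_cast hs.card_ne_zero
  rw [avgSqRadius]
  simp_rw [norm_sub_sq_real]
  rw [Finset.sum_add_distrib, Finset.sum_sub_distrib, ← Finset.mul_sum, ← sum_inner,
    Finset.sum_const, nsmul_eq_mul, inner_smul_right, real_inner_self_eq_norm_sq, norm_smul,
    Real.norm_of_nonneg (by positivity)]
  field_simp
  ring

lemma lt_codeAvgSqRadius {a : ℝ} {C : Finset (EuclideanSpace ℝ (Fin n))}
    (h : ∀ s ⊆ C, s.card = L → a < avgSqRadius s) :
    (a : EReal) < codeAvgSqRadius L (C : Set (EuclideanSpace ℝ (Fin n))) := by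
  have hinf : codeAvgSqRadius L (C : Set (EuclideanSpace ℝ (Fin n))) =
      (C.powersetCard L).inf fun s => (avgSqRadius s : EReal) := by
    rw [codeAvgSqRadius, Finset.inf_eq_iInf]
    simp
  rw [hinf, Finset.lt_inf_iff (EReal.coe_lt_top a)]
  intro s hs
  rw [Finset.mem_powersetCard] at hs
  exact_mod_cast h s hs.1 hs.2

lemma isAvgRadPacking_of_subset_sphere {C : Finset (EuclideanSpace ℝ (Fin n))} (hL : L ≠ 0)
    (hP : 0 ≤ P) (hC : (C : Set (EuclideanSpace ℝ (Fin n))) ⊆ Metric.sphere 0 √(n * P))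
    (hsum : ∀ s ⊆ C, s.card = L → ‖∑ x ∈ s, x‖ ^ 2 < L ^ 2 * (n * (P - N))) :
    IsAvgRadPacking P N L (C : Set (EuclideanSpace ℝ (Fin n))) := by
  refine ⟨hC.trans Metric.sphere_subset_closedBall, lt_codeAvgSqRadius fun s hs hsL => ?_⟩
  have hnorm : ∀ x ∈ s, ‖x‖ ^ 2 = n * P := fun x hx => by
    rw [mem_sphere_zero_iff_norm.1 (hC (hs hx)), Real.sq_sqrt (by positivity)]
  rw [avgSqRadius_eq, Finset.sum_congr rfl hnorm, Finset.sum_const, hsL, nsmul_eq_mul,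
    mul_div_cancel_left₀ _ (by exact_mod_cast hL), lt_sub_comm, div_lt_iff₀' (by positivity)]
  linarith [hsum s hs hsL]

lemma exists_packing_of_unit_code {C : Finset (EuclideanSpace ℝ (Fin n))} (hn : 0 < n)
    (hL : L ≠ 0) (hP : 0 < P) (hC : ∀ x ∈ C, ‖x‖ = 1)
    (hsum : ∀ s ⊆ C, s.card = L → ‖∑ x ∈ s, x‖ ^ 2 < L * (L * (P - N) / P)) :
    ∃ D : Finset (EuclideanSpace ℝ (Fin n)),
      (D : Set (EuclideanSpace ℝ (Fin n))) ⊆ Metric.sphere 0 √(n * P) ∧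
      IsAvgRadPacking P N L (D : Set (EuclideanSpace ℝ (Fin n))) ∧ D.card = C.card := by
  classical
  have hr : 0 < √(n * P) := by positivity
  have hinj : Function.Injective fun x : EuclideanSpace ℝ (Fin n) => √(n * P) • x :=
    smul_right_injective _ hr.ne'
  have hsphere : ((C.image fun x => √(n * P) • x : Finset _) : Set (EuclideanSpace ℝ (Fin n))) ⊆
      Metric.sphere 0 √(n * P) := by
    intro y hy
    obtain ⟨x, hx, rfl⟩ := Finset.mem_image.1 (Finset.mem_coe.1 hy)
    rw [mem_sphere_zero_iff_norm, norm_smul, hC x hx, mul_one, Real.norm_of_nonneg hr.le]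
  refine ⟨_, hsphere, isAvgRadPacking_of_subset_sphere hL hP.le hsphere fun s hs hsL => ?_,
    Finset.card_image_of_injective C hinj⟩
  obtain ⟨t, ht, rfl⟩ := Finset.subset_image_iff.1 hs
  rw [Finset.card_image_of_injective _ hinj] at hsL
  rw [Finset.sum_image hinj.injOn, ← Finset.smul_sum, norm_smul, mul_pow,
    Real.norm_of_nonneg hr.le, Real.sq_sqrt (by positivity)]
  calc n * P * ‖∑ x ∈ t, x‖ ^ 2 < n * P * (L * (L * (P - N) / P)) := by
        gcongr
        exact hsum t ht hsL
    _ = L ^ 2 * (n * (P - N)) := by field_simp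

lemma exists_singleton_packing (N : ℝ) (hn : 0 < n) (hL : 2 ≤ L) (hP : 0 < P) :
    ∃ C : Finset (EuclideanSpace ℝ (Fin n)),
      (C : Set (EuclideanSpace ℝ (Fin n))) ⊆ Metric.sphere 0 √(n * P) ∧
      IsAvgRadPacking P N L (C : Set (EuclideanSpace ℝ (Fin n))) ∧ C.card = 1 := by
  refine exists_packing_of_unit_code (C := {EuclideanSpace.single ⟨0, hn⟩ 1}) hn (by omega) hP
    (by simp) fun s hs hsL => ?_
  have hcard := Finset.card_le_card hs
  rw [Finset.card_singleton] at hcard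
  omega

lemma le_rate (hn : 0 < n) {R : ℝ} {C : Finset (EuclideanSpace ℝ (Fin n))}
    (hR : Real.exp (n * R) ≤ C.card) : (R : EReal) ≤ rate (C : Set (EuclideanSpace ℝ (Fin n))) := by
  rw [rate, EReal.le_div_iff_mul_le (by exact_mod_cast hn) (EReal.natCast_ne_top n),
    Set.encard_coe_eq_coe_finsetCard]
  calc (R : EReal) * n = ENNReal.log (ENNReal.ofReal (Real.exp (n * R))) := by
        rw [ENNReal.log_ofReal_of_pos (Real.exp_pos _), Real.log_exp, mul_comm (n : ℝ)]
        norm_cast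
    _ ≤ ENNReal.log (C.card : ENNReal) := by
        refine ENNReal.log_monotone ?_
        rw [← ENNReal.ofReal_natCast]
        exact ENNReal.ofReal_le_ofReal hR

end Packing

section Capacity

variable {P N : ℝ}

lemma lowerBound_eq (P N : ℝ) (L : ℕ) :
    lowerBound P N L = -(Real.log (L * N / ((L - 1) * P)) +
      Real.log (L * (P - N) / P) / (L - 1)) / 2 := by
  rw [lowerBound, ← inv_div (L * N), ← inv_div (L * (P - N)), Real.log_inv, Real.log_inv]
  ring

lemma exp_pow_mul_sqrt_lt_one {κ μ R : ℝ} {k : ℕ} (hk : k ≠ 0) (hκ : 0 < κ) (hμ : 0 < μ)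
    (hR : R < -(Real.log κ + Real.log μ / k) / 2) :
    Real.exp R ^ k * √(μ * κ ^ k) < 1 := by
  have hk0 : (0 : ℝ) < k := by positivity
  have hneg : k * R + (Real.log μ + k * Real.log κ) / 2 < 0 := by
    have h := mul_lt_mul_of_pos_left hR hk0
    have hcancel : k * (-(Real.log κ + Real.log μ / k) / 2) =
        -(Real.log μ + k * Real.log κ) / 2 := by
      field_simp
      ring
    linarith
  rw [← Real.log_neg_iff (by positivity), Real.log_mul (by positivity) (by positivity),
    Real.log_pow, Real.log_exp, Real.log_sqrt (by positivity),
    Real.log_mul (by positivity) (by positivity), Real.log_pow]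
  exact hneg

lemma eventually_exists_packing (hP : 0 < P) (hN : 0 < N) {L : ℕ} (hL : 2 ≤ L)
    (hNP : N / P ≤ ((L : ℝ) - 1) / L) {R : ℝ} (hR : R < lowerBound P N L) :
    ∀ᶠ n : ℕ in atTop, ∃ C : Finset (EuclideanSpace ℝ (Fin n)),
      (C : Set (EuclideanSpace ℝ (Fin n))) ⊆ Metric.sphere 0 √(n * P) ∧
      IsAvgRadPacking P N L (C : Set (EuclideanSpace ℝ (Fin n))) ∧
      Real.exp (n * R) ≤ C.card := by
  rcases lt_or_ge R 0 with hR0 | hR0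
  · filter_upwards [eventually_gt_atTop 0] with n hn
    obtain ⟨C, hsphere, hpack, hcard⟩ := exists_singleton_packing N hn hL hP
    refine ⟨C, hsphere, hpack, ?_⟩
    rw [hcard, Nat.cast_one, Real.exp_le_one_iff]
    exact mul_nonpos_of_nonneg_of_nonpos (Nat.cast_nonneg n) hR0.le
  have hL1 : ((L - 1 : ℕ) : ℝ) = L - 1 := Nat.cast_pred (by omega)
  have hL1pos : (0 : ℝ) < L - 1 := by rw [← hL1]; exact_mod_cast (by omega : 0 < L - 1)
  have hLN : L * N ≤ (L - 1) * P := by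
    rwa [div_le_div_iff₀ hP (by linarith), mul_comm N] at hNP
  have hPN : 0 < P - N := by nlinarith
  have : (0 : ℝ) < L := by linarith
  filter_upwards [eventually_gt_atTop 0,
    eventually_exists_unit_code (κ := L * N / ((L - 1) * P)) (μ := L * (P - N) / P) hL
      (by positivity) (div_le_one_of_le₀ hLN (by positivity)) (by field_simp; ring) hR0
      (exp_pow_mul_sqrt_lt_one (by omega) (by positivity) (by positivity)
        (by rwa [hL1, ← lowerBound_eq]))] with n hn hcode
  obtain ⟨C, hC, hsum, hcard⟩ := hcode
  obtain ⟨D, hsphere, hpack, hD⟩ := exists_packing_of_unit_code hn (by omega) hP hC hsum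
  exact ⟨D, hsphere, hpack, by rwa [hD]⟩

lemma lowerBound_le_sphericalCapacity (hP : 0 < P) (hN : 0 < N) {L : ℕ} (hL : 2 ≤ L)
    (hNP : N / P ≤ ((L : ℝ) - 1) / L) :
    (lowerBound P N L : EReal) ≤ sphericalCapacity P N L := by
  refine EReal.ge_of_forall_gt_iff_ge.1 fun R hR => ?_
  refine le_limsup_of_frequently_le (Eventually.frequently ?_) (by isBoundedDefault)
  filter_upwards [eventually_exists_packing hP hN hL hNP (by exact_mod_cast hR),
    eventually_gt_atTop 0] with n ⟨C, hsphere, hpack, hcard⟩ hn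
  exact (le_rate hn hcard).trans (le_iSup₂_of_le (C : Set _) ⟨hsphere, hpack⟩ le_rfl)

lemma sphericalCapacity_le_capacity (P N : ℝ) (L : ℕ) :
    sphericalCapacity P N L ≤ capacity P N L :=
  limsup_le_limsup (Eventually.of_forall fun _ => biSup_mono fun _ hC => hC.2)

lemma tendsto_lowerBound (hN : 0 < N) (hNP : N < P) :
    Tendsto (fun L : ℕ => lowerBound P N L) atTop (𝓝 (1 / 2 * Real.log (P / N))) := by
  have := sub_pos.2 hNP
  have hP := hN.trans hNP
  have hL : Tendsto (fun L : ℕ => (L : ℝ)) atTop atTop := tendsto_natCast_atTop_atTop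
  have hmain : Tendsto (fun L : ℕ => Real.log (((L : ℝ) - 1) * P / (L * N))) atTop
      (𝓝 (Real.log (P / N))) := by
    have hratio : Tendsto (fun L : ℕ => (1 - (L : ℝ)⁻¹) * (P / N)) atTop (𝓝 (P / N)) := by
      simpa using ((tendsto_inv_atTop_zero.comp hL).const_sub 1).mul_const (P / N)
    refine (hratio.log (by positivity)).congr' ?_
    filter_upwards [eventually_gt_atTop 0] with L hL0
    congr 1
    field_simp
  have hrest : Tendsto (fun L : ℕ => 1 / ((L : ℝ) - 1) * Real.log (P / (L * (P - N)))) atTop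
      (𝓝 0) := by
    have hlog : Tendsto (fun x : ℝ => Real.log (P / (P - N)) * (1 / (x - 1)) -
        Real.log x ^ 1 / (1 * x + -1)) atTop (𝓝 (Real.log (P / (P - N)) * 0 - 0)) := by
      refine Tendsto.sub (Tendsto.const_mul _ ?_)
        (Real.tendsto_pow_log_div_mul_add_atTop 1 (-1) 1 one_ne_zero)
      simp_rw [one_div]
      exact tendsto_inv_atTop_zero.comp (tendsto_atTop_add_const_right _ (-1) tendsto_id)
    rw [mul_zero, sub_zero] at hlog
    refine (hlog.comp hL).congr' ?_
    filter_upwards [eventually_gt_atTop 0] with L hL0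
    rw [Function.comp_apply, mul_comm (L : ℝ), ← div_div,
      Real.log_div (by positivity) (by positivity : (L : ℝ) ≠ 0)]
    ring
  simpa only [lowerBound, add_zero] using (hmain.add hrest).const_mul (1 / 2)

end Capacity

end AvgRadPacking

end

theorem mainTheorem1 (P N : ℝ) (hP : 0 < P) (hN : 0 < N) :
    (∀ L : ℕ, 2 ≤ L → N / P ≤ ((L : ℝ) - 1) / L →
      (AvgRadPacking.lowerBound P N L : EReal) ≤ AvgRadPacking.capacity P N L ∧
      (AvgRadPacking.lowerBound P N L : EReal) ≤ AvgRadPacking.sphericalCapacity P N L) ∧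
    (N < P → Filter.Tendsto (fun L : ℕ => AvgRadPacking.lowerBound P N L) Filter.atTop
      (nhds (1 / 2 * Real.log (P / N)))) := by
  refine ⟨fun L hL hNP => ?_, fun hNP => AvgRadPacking.tendsto_lowerBound hN hNP⟩
  have hspherical := AvgRadPacking.lowerBound_le_sphericalCapacity hP hN hL hNP
  exact ⟨hspherical.trans (AvgRadPacking.sphericalCapacity_le_capacity P N L), hspherical⟩
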